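/- For $n\ge 0$ let $c_n=\int_0^1 x(x+1)\cdots(x+n-1)\,dx$ (with $c_0=1$) be the Cauchy numbers of the second kind. A real sequence $\{a_n\}_{n\ge0}$ is called completely monotonic if $(-1)^k\Delta^k a_n\ge 0$ for all $n,k\ge0$, where $\Delta^k a_n=\sum_{m=0}^k(-1)^m\binom{k}{m}a_{n+k-m}$. A completely monotonic sequence $\{a_n\}_{n\ge0}$ is called minimal if, for every real $b<a_0$, the sequence $b,a_1,a_2,\dots$ is not completely monotonic. The sequence $\{c_n/n!\}_{n\ge0}$ is completely monotonic and minimal. Moreover, there is a non-decreasing right-continuous function $\alpha:\mathbb{R}\to\mathbb{R}$, continuous at $0$ (in particular bounded on $[0,1]$), such that $$\frac{c_n}{n!}=\int_{[0,1]}t^n\,d\alpha(t)\qquad\text{for all } n\ge0,$$ where the integral is the Lebesgue–Stieltjes integral (with $0^0=1$). -/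

import Mathlib

/-- The `n`-th Cauchy number of the second kind, `c_n = ∫₀¹ x (x + 1) ⋯ (x + n - 1) dx`
(`ascPochhammer ℝ n` is the rising factorial polynomial of degree `n`). -/
noncomputable def cauchyNumberSecond (n : ℕ) : ℝ :=
  ∫ x in (0 : ℝ)..1, (ascPochhammer ℝ n).eval x

/-- A real sequence `a` is completely monotonic if `(-1)^k Δ^k a_n ≥ 0` for all `n, k ≥ 0`,
where `Δ a_n = a_{n+1} - a_n`. The case `k = 0` says that the terms are non-negative. -/
def CompletelyMonotonicSeq (a : ℕ → ℝ) : Prop :=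
  ∀ n k : ℕ, 0 ≤ (-1 : ℝ) ^ k * (fwdDiff 1)^[k] a n

/-- A completely monotonic sequence is minimal (in the sense of Widder) if it ceases to be
completely monotonic whenever its first term `a 0` is replaced by a smaller number. -/
def MinimalCompletelyMonotonicSeq (a : ℕ → ℝ) : Prop :=
  CompletelyMonotonicSeq a ∧
    ∀ b : ℝ, b < a 0 → ¬ CompletelyMonotonicSeq (Function.update a 0 b)

/-!
For `0 < x < 1` the number `(x)_n / n!`, where `(x)_n` is the rising factorial, is the `n`-th
moment of the Beta distribution with parameters `x` and `1 - x`, because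
`Γ(x + n) Γ(1 - x) / Γ(n + 1) = (x)_n / n! * Γ(x) Γ(1 - x)` (`lintegral_pow_mul_arcsineDensity`).
By Tonelli's theorem, averaging over `x ∈ (0, 1)` exhibits `c_n / n!` as the `n`-th moment of a
mixture of Beta distributions, an absolutely continuous probability measure on `(0, 1)`
(`arcsineMixture`). Its distribution function is the required `α`.

The rest holds for the moments `a n = ∫ t ^ n ∂μ` of any finite measure `μ` on `[0, 1]`: since
`(-1) ^ k Δ ^ k a n = ∫ t ^ n (1 - t) ^ k ∂μ`, they are completely monotonic. Lowering `a 0` by `ε`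
lowers `(-1) ^ k Δ ^ k a 0 = ∫ (1 - t) ^ k ∂μ` by `ε` for each `k`; as these integrals tend to
`μ {0}`, the moment sequence is minimal once `μ` has no atom at `0`.
-/

open MeasureTheory Set Filter Topology ProbabilityTheory

/-! ### Moment sequences of finite measures on the unit interval -/

lemma integrableOn_pow_mul_one_sub_pow (μ : Measure ℝ) [IsFiniteMeasure μ] (n k : ℕ) :
    IntegrableOn (fun t : ℝ => t ^ n * (1 - t) ^ k) (Icc 0 1) μ :=
  (by fun_prop : Continuous fun t : ℝ => t ^ n * (1 - t) ^ k).continuousOn.integrableOn_compact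
    isCompact_Icc

lemma neg_one_pow_mul_fwdDiff_iter_moment (μ : Measure ℝ) [IsFiniteMeasure μ] (k n : ℕ) :
    (-1 : ℝ) ^ k * (fwdDiff 1)^[k] (fun n : ℕ => ∫ t in Icc (0 : ℝ) 1, t ^ n ∂μ) n =
      ∫ t in Icc (0 : ℝ) 1, t ^ n * (1 - t) ^ k ∂μ := by
  induction k generalizing n with
  | zero => simp
  | succ k ih =>
    rw [Function.iterate_succ_apply', fwdDiff, pow_succ]
    calc _ = (∫ t in Icc (0 : ℝ) 1, t ^ n * (1 - t) ^ k ∂μ) -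
          ∫ t in Icc (0 : ℝ) 1, t ^ (n + 1) * (1 - t) ^ k ∂μ := by
          rw [← ih, ← ih]; ring
      _ = _ := by
          rw [← integral_sub (integrableOn_pow_mul_one_sub_pow μ n k)
            (integrableOn_pow_mul_one_sub_pow μ (n + 1) k)]
          congr 1 with t
          ring

lemma completelyMonotonicSeq_moment (μ : Measure ℝ) [IsFiniteMeasure μ] :
    CompletelyMonotonicSeq (fun n : ℕ => ∫ t in Icc (0 : ℝ) 1, t ^ n ∂μ) := by
  intro n k
  rw [neg_one_pow_mul_fwdDiff_iter_moment]
  refine setIntegral_nonneg measurableSet_Icc fun t ht => ?_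
  exact mul_nonneg (pow_nonneg ht.1 n) (pow_nonneg (sub_nonneg.2 ht.2) k)

lemma neg_one_pow_mul_fwdDiff_iter_update_zero (a : ℕ → ℝ) (b : ℝ) (k : ℕ) :
    (-1 : ℝ) ^ k * (fwdDiff 1)^[k] (Function.update a 0 b) 0 =
      (-1 : ℝ) ^ k * (fwdDiff 1)^[k] a 0 - (a 0 - b) := by
  have hsq : (-1 : ℝ) ^ k * (-1) ^ k = 1 := by rw [← mul_pow]; norm_num
  -- Only the term of index `0` in the binomial expansion of `Δ ^ k` involves the changed value.
  simp only [fwdDiff_iter_eq_sum_shift, Finset.sum_range_succ']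
  simp only [smul_eq_mul, mul_one, zero_add, ne_eq, Nat.add_eq_zero_iff, one_ne_zero, and_false,
    not_false_eq_true, Function.update_of_ne, Function.update_self, zsmul_eq_mul]
  push_cast
  simp only [Nat.sub_zero, Nat.choose_zero_right, Nat.cast_one, mul_one]
  linear_combination (b - a 0) * hsq

/-- In general the limit is `μ {0}`, the integrand tending to the indicator function of `{0}`. -/
lemma tendsto_integral_one_sub_pow (μ : Measure ℝ) [IsFiniteMeasure μ] (h0 : μ {0} = 0) :
    Tendsto (fun k : ℕ => ∫ t in Icc (0 : ℝ) 1, (1 - t) ^ k ∂μ) atTop (𝓝 0) := by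
  have hne : ∀ᵐ t ∂μ.restrict (Icc (0 : ℝ) 1), t ≠ 0 :=
    ae_restrict_of_ae (measure_eq_zero_iff_ae_notMem.1 h0)
  have hmem : ∀ᵐ t ∂μ.restrict (Icc (0 : ℝ) 1), t ∈ Icc (0 : ℝ) 1 :=
    ae_restrict_mem measurableSet_Icc
  suffices h : Tendsto (fun k : ℕ => ∫ t in Icc (0 : ℝ) 1, (1 - t) ^ k ∂μ) atTop
      (𝓝 (∫ _ in Icc (0 : ℝ) 1, (0 : ℝ) ∂μ)) by simpa using h
  refine tendsto_integral_of_dominated_convergence (fun _ => (1 : ℝ))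
    (fun k => by fun_prop) (integrable_const _) (fun k => ?_) ?_
  · filter_upwards [hmem] with t ht
    rw [Real.norm_of_nonneg (pow_nonneg (sub_nonneg.2 ht.2) k)]
    exact pow_le_one₀ (sub_nonneg.2 ht.2) (by linarith [ht.1])
  · filter_upwards [hne, hmem] with t ht0 ht
    have : 0 < t := lt_of_le_of_ne ht.1 ht0.symm
    exact tendsto_pow_atTop_nhds_zero_of_lt_one (sub_nonneg.2 ht.2) (by linarith)

lemma minimalCompletelyMonotonicSeq_moment (μ : Measure ℝ) [IsFiniteMeasure μ]
    (h0 : μ {0} = 0) :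
    MinimalCompletelyMonotonicSeq (fun n : ℕ => ∫ t in Icc (0 : ℝ) 1, t ^ n ∂μ) := by
  refine ⟨completelyMonotonicSeq_moment μ, fun b hb hcm => ?_⟩
  obtain ⟨k, hk⟩ := ((tendsto_integral_one_sub_pow μ h0).eventually_lt_const
    (sub_pos.2 hb)).exists
  have h := hcm 0 k
  rw [neg_one_pow_mul_fwdDiff_iter_update_zero, neg_one_pow_mul_fwdDiff_iter_moment] at h
  simp only [pow_zero, one_mul] at h hk
  linarith

/-! ### Moments of the generalized arcsine distributions -/

/-- The density at `t ∈ (0, 1)` of the Beta distribution with parameters `x` and `1 - x` (a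
generalized arcsine distribution), the normalizing constant `1 / (Γ(x) Γ(1 - x))` being written as
`sin (π x) / π`. -/
noncomputable def arcsineDensity (x t : ℝ) : ℝ :=
  Real.sin (Real.pi * x) / Real.pi * t ^ (x - 1) * (1 - t) ^ (-x)

lemma measurable_arcsineDensity : Measurable (Function.uncurry arcsineDensity) := by
  unfold arcsineDensity Function.uncurry
  fun_prop

lemma Real.Gamma_add_nat_eq_ascPochhammer_mul {x : ℝ} (hx : 0 < x) (n : ℕ) :
    Real.Gamma (x + n) = (ascPochhammer ℝ n).eval x * Real.Gamma x := by
  induction n with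
  | zero => simp
  | succ n ih =>
    rw [Nat.cast_succ, ← add_assoc, Real.Gamma_add_one (by positivity), ih,
      ascPochhammer_succ_eval]
    ring

lemma beta_add_nat_one_sub {x : ℝ} (hx : x ∈ Ioo (0 : ℝ) 1) (n : ℕ) :
    beta (x + n) (1 - x) * (Real.sin (Real.pi * x) / Real.pi) =
      (ascPochhammer ℝ n).eval x / n.factorial := by
  have hsin : 0 < Real.sin (Real.pi * x) :=
    Real.sin_pos_of_pos_of_lt_pi (mul_pos Real.pi_pos hx.1)
      (by nlinarith [Real.pi_pos, hx.2])
  have hfac : (n.factorial : ℝ) ≠ 0 := by positivity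
  have hrefl := Real.Gamma_mul_Gamma_one_sub x
  rw [beta, Real.Gamma_add_nat_eq_ascPochhammer_mul hx.1,
    show x + n + (1 - x) = (n : ℝ) + 1 by ring, Real.Gamma_nat_eq_factorial, mul_assoc, hrefl]
  field_simp [hsin.ne', Real.pi_ne_zero]

/-- The product `t ^ n * arcsineDensity x t` is a multiple of the Beta density with parameters
`x + n` and `1 - x`, which has total mass `1`. -/
lemma lintegral_pow_mul_arcsineDensity {x : ℝ} (hx : x ∈ Ioo (0 : ℝ) 1) (n : ℕ) :
    ∫⁻ t in Ioo (0 : ℝ) 1, ENNReal.ofReal (t ^ n) * ENNReal.ofReal (arcsineDensity x t) =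
      ENNReal.ofReal ((ascPochhammer ℝ n).eval x / n.factorial) := by
  have hα : 0 < x + n := add_pos_of_pos_of_nonneg hx.1 n.cast_nonneg
  have hβ : 0 < 1 - x := sub_pos.2 hx.2
  have hbeta := beta_pos hα hβ
  have hmass := lintegral_betaPDF_eq_one hα hβ
  rw [lintegral_betaPDF] at hmass
  have hnonneg : 0 ≤ (ascPochhammer ℝ n).eval x / n.factorial :=
    div_nonneg (ascPochhammer_pos n x hx.1).le (by positivity)
  rw [← mul_one (ENNReal.ofReal ((ascPochhammer ℝ n).eval x / n.factorial)), ← hmass,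
    ← lintegral_const_mul _ (by fun_prop)]
  refine setLIntegral_congr_fun measurableSet_Ioo fun t ht => ?_
  have hpow : t ^ (x + n - 1) = t ^ n * t ^ (x - 1) := by
    rw [show x + n - 1 = (x - 1) + n by ring, Real.rpow_add_natCast ht.1.ne', mul_comm]
  rw [← ENNReal.ofReal_mul (pow_nonneg ht.1.le n), ← ENNReal.ofReal_mul hnonneg,
    ← beta_add_nat_one_sub hx, hpow, arcsineDensity, show 1 - x - 1 = -x by ring]
  congr 1
  field_simp

/-! ### The representing measure of the Cauchy numbers -/

/-- The mixture, over `x` uniform in `(0, 1)`, of the Beta distributions with parameters `x` and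
`1 - x`. -/
noncomputable def arcsineMixture : Measure ℝ :=
  (volume.restrict (Ioo (0 : ℝ) 1)).withDensity
    fun t => ∫⁻ x in Ioo (0 : ℝ) 1, ENNReal.ofReal (arcsineDensity x t)

lemma cauchyNumberSecond_div_factorial_nonneg (n : ℕ) :
    0 ≤ cauchyNumberSecond n / n.factorial := by
  refine div_nonneg ?_ (by positivity)
  rw [cauchyNumberSecond, intervalIntegral.integral_of_le zero_le_one]
  exact setIntegral_nonneg measurableSet_Ioc fun x hx => (ascPochhammer_pos n x hx.1).le

lemma lintegral_ascPochhammer_div_factorial (n : ℕ) :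
    ∫⁻ x in Ioo (0 : ℝ) 1, ENNReal.ofReal ((ascPochhammer ℝ n).eval x / n.factorial) =
      ENNReal.ofReal (cauchyNumberSecond n / n.factorial) := by
  have hcont : Continuous fun x : ℝ => (ascPochhammer ℝ n).eval x / (n.factorial : ℝ) := by
    fun_prop
  rw [← ofReal_integral_eq_lintegral_ofReal, cauchyNumberSecond,
    intervalIntegral.integral_of_le zero_le_one, integral_Ioc_eq_integral_Ioo, integral_div]
  · exact (hcont.continuousOn.integrableOn_compact isCompact_Icc).mono_set Ioo_subset_Icc_self
  · filter_upwards [ae_restrict_mem measurableSet_Ioo] with x hx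
    exact div_nonneg (ascPochhammer_pos n x hx.1).le (by positivity)

lemma lintegral_pow_arcsineMixture (n : ℕ) :
    ∫⁻ t, ENNReal.ofReal (t ^ n) ∂arcsineMixture =
      ENNReal.ofReal (cauchyNumberSecond n / n.factorial) := by
  have hmeas : Measurable fun p : ℝ × ℝ => ENNReal.ofReal (arcsineDensity p.2 p.1) :=
    (measurable_arcsineDensity.comp measurable_swap).ennreal_ofReal
  rw [arcsineMixture, lintegral_withDensity_eq_lintegral_mul _ hmeas.lintegral_prod_right'
    (by fun_prop), ← lintegral_ascPochhammer_div_factorial]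
  calc _ = ∫⁻ t in Ioo (0 : ℝ) 1, ∫⁻ x in Ioo (0 : ℝ) 1,
        ENNReal.ofReal (t ^ n) * ENNReal.ofReal (arcsineDensity x t) := by
        refine lintegral_congr fun t => ?_
        rw [Pi.mul_apply, mul_comm]
        exact (lintegral_const_mul _ (hmeas.comp measurable_prodMk_left)).symm
    _ = ∫⁻ x in Ioo (0 : ℝ) 1, ∫⁻ t in Ioo (0 : ℝ) 1,
        ENNReal.ofReal (t ^ n) * ENNReal.ofReal (arcsineDensity x t) := by
        refine lintegral_lintegral_swap (Measurable.aemeasurable ?_)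
        exact (by fun_prop : Measurable fun p : ℝ × ℝ => ENNReal.ofReal (p.1 ^ n)).mul hmeas
    _ = _ := setLIntegral_congr_fun measurableSet_Ioo fun x hx =>
        lintegral_pow_mul_arcsineDensity hx n

instance isProbabilityMeasure_arcsineMixture : IsProbabilityMeasure arcsineMixture where
  measure_univ := by
    have h := lintegral_pow_arcsineMixture 0
    simpa [cauchyNumberSecond] using h

lemma ae_mem_Ioo_arcsineMixture : ∀ᵐ t ∂arcsineMixture, t ∈ Ioo (0 : ℝ) 1 :=
  (withDensity_absolutelyContinuous _ _).ae_le (ae_restrict_mem measurableSet_Ioo)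

lemma arcsineMixture_singleton_zero : arcsineMixture {0} = 0 :=
  measure_eq_zero_iff_ae_notMem.2 <| by
    filter_upwards [ae_mem_Ioo_arcsineMixture] with t ht
    exact ht.1.ne'

lemma cauchyNumberSecond_div_factorial_eq_moment (n : ℕ) :
    cauchyNumberSecond n / (n.factorial : ℝ) =
      ∫ t in Icc (0 : ℝ) 1, t ^ n ∂arcsineMixture := by
  have hIcc : arcsineMixture.restrict (Icc (0 : ℝ) 1) = arcsineMixture :=
    Measure.restrict_eq_self_of_ae_mem
      (ae_mem_Ioo_arcsineMixture.mono fun _ ht => Ioo_subset_Icc_self ht)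
  rw [hIcc, integral_eq_lintegral_of_nonneg_ae _ (by fun_prop), lintegral_pow_arcsineMixture,
    ENNReal.toReal_ofReal (cauchyNumberSecond_div_factorial_nonneg n)]
  filter_upwards [ae_mem_Ioo_arcsineMixture] with t ht
  exact pow_nonneg ht.1.le n

/-! ### The moment representation -/

lemma StieltjesFunction.continuousAt_of_measure_singleton_eq_zero (f : StieltjesFunction ℝ)
    {x : ℝ} (h : f.measure {x} = 0) : ContinuousAt (fun t : ℝ => f t) x := by
  rw [f.measure_singleton, ENNReal.ofReal_eq_zero, sub_nonpos] at h
  rw [f.mono.continuousAt_iff_leftLim_eq_rightLim, f.rightLim_eq]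
  exact le_antisymm (f.mono.leftLim_le le_rfl) h

theorem mainTheorem2 :
    CompletelyMonotonicSeq (fun n : ℕ => cauchyNumberSecond n / (n.factorial : ℝ)) ∧
    MinimalCompletelyMonotonicSeq (fun n : ℕ => cauchyNumberSecond n / (n.factorial : ℝ)) ∧
    ∃ α : StieltjesFunction ℝ, ContinuousAt (fun t : ℝ => α t) 0 ∧
      ∀ n : ℕ, cauchyNumberSecond n / (n.factorial : ℝ) =
        ∫ t in Set.Icc (0 : ℝ) 1, t ^ n ∂α.measure := by
  have hmin : MinimalCompletelyMonotonicSeq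
      (fun n : ℕ => cauchyNumberSecond n / (n.factorial : ℝ)) := by
    simp only [cauchyNumberSecond_div_factorial_eq_moment]
    exact minimalCompletelyMonotonicSeq_moment _ arcsineMixture_singleton_zero
  refine ⟨hmin.1, hmin, cdf arcsineMixture, ?_, fun n => ?_⟩
  · apply StieltjesFunction.continuousAt_of_measure_singleton_eq_zero
    rw [measure_cdf, arcsineMixture_singleton_zero]
  · rw [measure_cdf, cauchyNumberSecond_div_factorial_eq_moment]
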